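/- Let $A$ be a finite-dimensional algebra over a field. All modules are finitely generated; $A\text{-mod}$ and $\text{mod-}A$ denote the categories of left and right $A$-modules. For an $A$-module $N$ put $\operatorname{grade}(N)=\inf\{n\ge 0 : \operatorname{Ext}^n_A(N,A)\neq 0\}$, with $\operatorname{Ext}^0_A=\operatorname{Hom}_A$ and $\inf\emptyset=\infty$ (so $\operatorname{grade}(0)=\infty$). For $M\in A\text{-mod}$ let $t(M)$ be the kernel of the canonical map $M\to M^{**}$, where $(-)^*=\operatorname{Hom}_A(-,A)$. For $M\in\text{mod-}A$, regard $\operatorname{Ext}^i_A(M,A)$ as a left $A$-module through left multiplication on $A$. Let $0\to A\to I_0\to I_1\to\cdots$ be a minimal injective coresolution of the left module $A$; the dominant dimension $\operatorname{domdim}A$ is the least $n\ge 0$ such that $I_n$ is not projective, and $\infty$ if all $I_n$ are projective. Suppose that $$\inf\{\operatorname{grade}(\operatorname{Ext}^i_A(M,A)) : M\in\text{mod-}A,\ i\ge 1\}\ge 2 \quad\text{or}\quad \inf\{\operatorname{grade}(t(M)) : M\in A\text{-mod}\}\ge 2 .$$ Then $$\operatorname{domdim}A=\inf\{\operatorname{grade}(\operatorname{Ext}^i_A(M,A))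 : M\in\text{mod-}A,\ i\ge 1\}=\inf\{\operatorname{grade}(t(M)) : M\in A\text{-mod}\}=\inf\{\operatorname{grade}(t(S)) : S\text{ a simple left } A\text{-module}\}.$$ -/

import Mathlib

open CategoryTheory CategoryTheory.Abelian MulOpposite

universe u v

noncomputable section

/-! Left `A`-modules are objects of `ModuleCat.{u} A`, right `A`-modules are objects of
`ModuleCat.{u} Aᵐᵒᵖ`, where `A : Type u`. -/

section Grade

variable (A : Type u) [Ring A]

/-- The grade of a left `A`-module `N`: the least `n ≥ 0` with `Ext_A^n(N, A) ≠ 0`, and `⊤` if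
there is no such `n` (in particular for `N = 0`). -/
def moduleGrade (N : Type u) [AddCommGroup N] [Module A N] : ℕ∞ :=
  ⨅ (n : ℕ) (_ : Nontrivial (Ext (ModuleCat.of A N) (ModuleCat.of A A) n)), (n : ℕ∞)

end Grade

section RegularExt

variable {A : Type u} [Ring A]

/-- Left multiplication by `a`, as an endomorphism of the right `A`-module `A`. -/
def leftMulHom (a : A) : ModuleCat.of Aᵐᵒᵖ A ⟶ ModuleCat.of Aᵐᵒᵖ A :=
  ModuleCat.ofHom (Module.toModuleEnd Aᵐᵒᵖ A a)

lemma leftMulHom_one : leftMulHom (1 : A) = 𝟙 _ := by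
  unfold leftMulHom; rw [map_one]; rfl

lemma leftMulHom_mul (a b : A) : leftMulHom (a * b) = leftMulHom b ≫ leftMulHom a := by
  unfold leftMulHom; rw [map_mul]; rfl

lemma leftMulHom_zero : leftMulHom (0 : A) = 0 := by
  unfold leftMulHom; rw [map_zero]; rfl

lemma leftMulHom_add (a b : A) : leftMulHom (a + b) = leftMulHom a + leftMulHom b := by
  unfold leftMulHom; rw [map_add]; rfl

/-- The group `Ext_A^i(M, A)` for a right `A`-module `M`. It is a left `A`-module through the left
multiplication of `A` on the second argument. -/
def RegularExt (M : ModuleCat.{u} Aᵐᵒᵖ) (i : ℕ) : Type u :=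
  Ext M (ModuleCat.of Aᵐᵒᵖ A) i

instance (M : ModuleCat.{u} Aᵐᵒᵖ) (i : ℕ) : AddCommGroup (RegularExt M i) :=
  inferInstanceAs (AddCommGroup (Ext M (ModuleCat.of Aᵐᵒᵖ A) i))

/-- The action of `a` on `Ext_A^i(M, A)` is the map induced by left multiplication by `a`. -/
def RegularExt.act {M : ModuleCat.{u} Aᵐᵒᵖ} {i : ℕ} (a : A)
    (e : Ext M (ModuleCat.of Aᵐᵒᵖ A) i) : Ext M (ModuleCat.of Aᵐᵒᵖ A) i :=
  e.comp (Ext.mk₀ (leftMulHom a)) (add_zero i)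

instance (M : ModuleCat.{u} Aᵐᵒᵖ) (i : ℕ) : Module A (RegularExt M i) where
  smul a e := RegularExt.act a e
  one_smul e := by
    change RegularExt.act 1 e = e
    unfold RegularExt.act
    rw [leftMulHom_one]
    exact Ext.comp_mk₀_id e
  mul_smul a b e := by
    change RegularExt.act (a * b) e = RegularExt.act a (RegularExt.act b e)
    unfold RegularExt.act
    rw [leftMulHom_mul, ← Ext.mk₀_comp_mk₀]
    exact (Ext.comp_assoc_of_third_deg_zero _ _ _ _).symm
  smul_zero a := by
    change RegularExt.act a 0 = (0 : Ext M (ModuleCat.of Aᵐᵒᵖ A) i)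
    exact Ext.zero_comp ..
  smul_add a e f := by
    change RegularExt.act a (Add.add (α := Ext M (ModuleCat.of Aᵐᵒᵖ A) i) e f) =
      RegularExt.act a e + RegularExt.act a f
    exact Ext.add_comp ..
  add_smul a b e := by
    change RegularExt.act (a + b) e = RegularExt.act a e + RegularExt.act b e
    unfold RegularExt.act
    rw [leftMulHom_add, Ext.mk₀_add]
    exact Ext.comp_add ..
  zero_smul e := by
    change RegularExt.act 0 e = (0 : Ext M (ModuleCat.of Aᵐᵒᵖ A) i)
    unfold RegularExt.act
    rw [leftMulHom_zero, Ext.mk₀_zero]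
    exact Ext.comp_zero ..

end RegularExt

section Torsion

variable (A : Type u) [Ring A] (M : Type u) [AddCommGroup M] [Module A M]

/-- The canonical map `M → M**`, `m ↦ (f ↦ f m)`, where `M* = Hom_A(M, A)` is a right `A`-module
through right multiplication on the values, and `M** = Hom_A(M*, A)` is a left `A`-module through
left multiplication on the values. -/
def bidualMap : M →ₗ[A] ((M →ₗ[A] A) →ₗ[Aᵐᵒᵖ] A) where
  toFun m :=
    { toFun := fun f => f m
      map_add' := fun _ _ => rfl
      map_smul' := fun _ _ => rfl }
  map_add' m n := by ext f; exact map_add f m n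
  map_smul' a m := by ext f; exact map_smul f a m

/-- The torsion module `t(M)`: the kernel of the canonical map `M → M**`. -/
def torsionPart : Submodule A M := LinearMap.ker (bidualMap A M)

end Torsion

section DominantDimension

variable (A : Type u) [Ring A]

/-- A submodule `N` of `I` is essential if it meets every non-zero submodule of `I`. -/
def IsEssentialSubmodule {I : Type u} [AddCommGroup I] [Module A I] (N : Submodule A I) : Prop :=
  ∀ X : Submodule A I, N ⊓ X = ⊥ → X = ⊥

/-- A minimal injective coresolution `0 → M → I 0 → I 1 → ⋯` of a left `A`-module `M`: an exact
sequence with all `I n` injective in which `I 0` is an injective hull of the image of `M` and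
`I (n + 1)` is an injective hull of the image of `I n`. -/
structure MinimalInjectiveCoresolution (M : Type u) [AddCommGroup M] [Module A M] where
  I : ℕ → ModuleCat.{u} A
  ι : M →ₗ[A] I 0
  d : ∀ n, I n →ₗ[A] I (n + 1)
  injective : ∀ n, Module.Injective A (I n)
  ι_injective : Function.Injective ι
  exact_zero : Function.Exact ι (d 0)
  exact_succ : ∀ n, Function.Exact (d n) (d (n + 1))
  essential_zero : IsEssentialSubmodule A (LinearMap.range ι)
  essential_succ : ∀ n, IsEssentialSubmodule A (LinearMap.range (d n))

/-- The dominant dimension of a left `A`-module `M`: the least `n` such that the `n`-th term of the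
minimal injective coresolution of `M` is not projective, and `⊤` if all terms are projective.
(Minimal injective coresolutions exist and are unique up to isomorphism, so the infimum over all of
them is the common value.) -/
def domdim (M : Type u) [AddCommGroup M] [Module A M] : ℕ∞ :=
  ⨅ (R : MinimalInjectiveCoresolution A M) (n : ℕ) (_ : ¬ Module.Projective A (R.I n)), (n : ℕ∞)

end DominantDimension

section Infima

variable (A : Type u) [Ring A]

/-- The infimum of the grades of the left modules `Ext_A^i(M, A)`, where `M` runs over the finitely
generated right `A`-modules and `i ≥ 1`. -/
def infGradeExt : ℕ∞ :=
  ⨅ (M : ModuleCat.{u} Aᵐᵒᵖ) (_ : Module.Finite Aᵐᵒᵖ M) (i : ℕ) (_ : 1 ≤ i),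
    moduleGrade A (RegularExt M i)

/-- The infimum of the grades of `t(M)`, where `M` runs over the finitely generated left
`A`-modules. -/
def infGradeTorsion : ℕ∞ :=
  ⨅ (M : ModuleCat.{u} A) (_ : Module.Finite A M), moduleGrade A (torsionPart A M)

/-- The infimum of the grades of `t(S)`, where `S` runs over the simple left `A`-modules. -/
def infGradeTorsionSimple : ℕ∞ :=
  ⨅ (S : ModuleCat.{u} A) (_ : IsSimpleModule A S), moduleGrade A (torsionPart A S)

end Infima

end

/-! Write torsion for a left module `N` with `Hom(N, A) = 0`, equivalently `t(N) = N`.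

The equality of the infimum over the modules `Ext^i(M, A)` with the infimum over the modules `t(M)`
needs no hypothesis. The cokernels `Y` and `M` of adjoint maps `A^m → A^n` of right modules and
`A^n → A^m` of left modules satisfy `Ext^1(Y, A) ≅ t(M)`
(`nonempty_regularExt_one_linearEquiv_torsionPart`), every finitely generated module is such a
cokernel, and the higher Ext modules are `Ext^1` of syzygies.

If all `t(M)` have grade at least two, the finitely generated torsion modules are closed under
submodules: a map `N → A` on a submodule of a torsion module `M` extends to `M`, since
`Ext^1(M ⧸ N, A) = 0` (`IsTorsionOverRegular.submodule`). So the composition factors of a torsion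
module are torsion simple modules, Ext vanishing passes from these to all torsion modules, and the
infimum of the grades may be taken over the simple modules
(`infGradeTorsion_eq_infGradeTorsionSimple`).

Let `0 → A → I_0 → I_1 → ⋯` be a minimal injective coresolution and `S` a simple module. By
minimality, `Ext^n(S, A) = 0` if and only if `Hom(S, I_n) = 0`
(`MinimalInjectiveCoresolution.subsingleton_ext_iff`). On the other hand `I_n` is finitely
generated, and it is projective if and only if it has no torsion simple submodule
(`projective_iff_forall_simple`): a torsion module has no non-zero map to a projective one, and
conversely the absence of torsion simple submodules forces `t(I_n) = 0`, so that `I_n` embeds in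
some `A^m` and splits off. Hence the first non-projective `I_n` occurs at the least `n` with
`Ext^n(S, A) ≠ 0` for a torsion simple `S` (`domdim_eq_infGradeTorsionSimple`). The finitely
generated injective hulls that this uses are cut out of the coinduced modules `Hom_k(A, M)`. -/

noncomputable section

/-! ### Vanishing of Ext over a ring -/

section ExtVanishing

variable {A : Type u} [Ring A]

/-- Isomorphic first arguments have isomorphic Ext groups. -/
lemma nontrivial_ext_of_linearEquiv {N N' : Type u} [AddCommGroup N] [Module A N]
    [AddCommGroup N'] [Module A N'] (e : N ≃ₗ[A] N') (Y : ModuleCat.{u} A) (n : ℕ)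
    (h : Nontrivial (Ext (ModuleCat.of A N) Y n)) : Nontrivial (Ext (ModuleCat.of A N') Y n) := by
  have hinj : Function.Injective
      fun x : Ext (ModuleCat.of A N) Y n => (Ext.mk₀ e.toModuleIso.inv).comp x (zero_add n) := by
    intro x y hxy
    have := congrArg (fun z => (Ext.mk₀ e.toModuleIso.hom).comp z (zero_add n)) hxy
    simpa only [Ext.mk₀_comp_mk₀_assoc, Iso.hom_inv_id, Ext.mk₀_id_comp] using this
  exact hinj.nontrivial

lemma moduleGrade_congr {N N' : Type u} [AddCommGroup N] [Module A N]
    [AddCommGroup N'] [Module A N'] (e : N ≃ₗ[A] N') : moduleGrade A N = moduleGrade A N' := by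
  have key (n : ℕ) : Nontrivial (Ext (ModuleCat.of A N) (ModuleCat.of A A) n) ↔
      Nontrivial (Ext (ModuleCat.of A N') (ModuleCat.of A A) n) :=
    ⟨nontrivial_ext_of_linearEquiv e _ n, nontrivial_ext_of_linearEquiv e.symm _ n⟩
  simp only [moduleGrade, key]

lemma moduleGrade_le {N : Type u} [AddCommGroup N] [Module A N] {n : ℕ}
    (h : Nontrivial (Ext (ModuleCat.of A N) (ModuleCat.of A A) n)) : moduleGrade A N ≤ n :=
  iInf₂_le n h

lemma le_moduleGrade {N : Type u} [AddCommGroup N] [Module A N] {c : ℕ∞}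
    (h : ∀ n : ℕ, Nontrivial (Ext (ModuleCat.of A N) (ModuleCat.of A A) n) → c ≤ n) :
    c ≤ moduleGrade A N :=
  le_iInf₂ h

lemma subsingleton_ext_of_lt_moduleGrade {N : Type u} [AddCommGroup N] [Module A N] {n : ℕ}
    (h : (n : ℕ∞) < moduleGrade A N) :
    Subsingleton (Ext (ModuleCat.of A N) (ModuleCat.of A A) n) := by
  by_contra hn
  exact absurd (moduleGrade_le (not_subsingleton_iff_nontrivial.mp hn)) (not_le.mpr h)

lemma subsingleton_ext_of_subsingleton (N : Type u) [AddCommGroup N] [Module A N] [Subsingleton N]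
    (Y : ModuleCat.{u} A) (n : ℕ) : Subsingleton (Ext (ModuleCat.of A N) Y n) := by
  refine subsingleton_of_forall_eq 0 fun x => ?_
  have h : 𝟙 (ModuleCat.of A N) = 0 := by ext y; exact Subsingleton.elim _ _
  rw [← Ext.mk₀_id_comp x, h, Ext.mk₀_zero, Ext.zero_comp]

lemma subsingleton_ext_zero_iff {N Y : Type u} [AddCommGroup N] [Module A N]
    [AddCommGroup Y] [Module A Y] :
    Subsingleton (Ext (ModuleCat.of A N) (ModuleCat.of A Y) 0) ↔ ∀ f : N →ₗ[A] Y, f = 0 := by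
  rw [Ext.homEquiv₀.subsingleton_congr, ModuleCat.homEquiv.subsingleton_congr]
  exact ⟨fun h f => Subsingleton.elim _ _, fun h => subsingleton_of_forall_eq 0 h⟩

lemma shortExact_of_exact {K M Q : Type u} [AddCommGroup K] [Module A K]
    [AddCommGroup M] [Module A M] [AddCommGroup Q] [Module A Q] (i : K →ₗ[A] M) (p : M →ₗ[A] Q)
    (hi : Function.Injective i) (hp : Function.Surjective p) (h : Function.Exact i p) :
    (ShortComplex.mk (ModuleCat.ofHom i) (ModuleCat.ofHom p)
      (by ext x; exact h.apply_apply_eq_zero x)).ShortExact where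
  exact := (ShortComplex.ShortExact.moduleCat_exact_iff_function_exact _).mpr h
  mono_f := (ModuleCat.mono_iff_injective _).mpr hi
  epi_g := (ModuleCat.epi_iff_surjective _).mpr hp

lemma subsingleton_ext_of_submodule_of_quotient {M : Type u} [AddCommGroup M] [Module A M]
    (N : Submodule A M) (Y : ModuleCat.{u} A) (n : ℕ)
    (h₁ : Subsingleton (Ext (ModuleCat.of A N) Y n))
    (h₂ : Subsingleton (Ext (ModuleCat.of A (M ⧸ N)) Y n)) :
    Subsingleton (Ext (ModuleCat.of A M) Y n) := by
  refine subsingleton_of_forall_eq 0 fun x => ?_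
  obtain ⟨y, rfl⟩ := Ext.contravariant_sequence_exact₂
    (shortExact_of_exact N.subtype N.mkQ N.subtype_injective N.mkQ_surjective
      (LinearMap.exact_subtype_mkQ N)) Y x (Subsingleton.elim _ _)
  rw [Subsingleton.elim y 0, Ext.comp_zero]

/-- If `Ext¹(M ⧸ N, Y) = 0`, every map `N → Y` extends to `M`. -/
lemma exists_extension_of_subsingleton_ext_one {M Y : Type u} [AddCommGroup M] [Module A M]
    [AddCommGroup Y] [Module A Y] (N : Submodule A M)
    (h : Subsingleton (Ext (ModuleCat.of A (M ⧸ N)) (ModuleCat.of A Y) 1)) (f : N →ₗ[A] Y) :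
    ∃ g : M →ₗ[A] Y, g ∘ₗ N.subtype = f := by
  obtain ⟨y, hy⟩ := Ext.contravariant_sequence_exact₁
    (shortExact_of_exact N.subtype N.mkQ N.subtype_injective N.mkQ_surjective
      (LinearMap.exact_subtype_mkQ N)) _ (Ext.mk₀ (ModuleCat.ofHom f)) (n₁ := 1) rfl
      (Subsingleton.elim _ _)
  obtain ⟨g, rfl⟩ := Ext.mk₀_bijective _ _ |>.2 y
  refine ⟨g.hom, ?_⟩
  rw [Ext.mk₀_comp_mk₀] at hy
  exact congrArg ModuleCat.Hom.hom ((Ext.mk₀_bijective _ _).1 hy)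

end ExtVanishing

/-! ### Torsion modules -/

section TorsionModules

variable {A : Type u} [Ring A]

variable (A) in
/-- A module is torsion if it has no non-zero map to `A`, that is, if `t(N) = N`. -/
def IsTorsionOverRegular (N : Type u) [AddCommGroup N] [Module A N] : Prop :=
  ∀ f : N →ₗ[A] A, f = 0

lemma mem_torsionPart_iff {M : Type u} [AddCommGroup M] [Module A M] {m : M} :
    m ∈ torsionPart A M ↔ ∀ f : M →ₗ[A] A, f m = 0 := by
  rw [torsionPart, LinearMap.mem_ker, LinearMap.ext_iff]
  rfl

lemma torsionPart_eq_top_iff {N : Type u} [AddCommGroup N] [Module A N] :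
    torsionPart A N = ⊤ ↔ IsTorsionOverRegular A N := by
  simp only [Submodule.eq_top_iff', mem_torsionPart_iff, IsTorsionOverRegular, LinearMap.ext_iff]
  exact forall_comm

lemma IsTorsionOverRegular.moduleGrade_torsionPart {N : Type u} [AddCommGroup N] [Module A N]
    (h : IsTorsionOverRegular A N) : moduleGrade A (torsionPart A N) = moduleGrade A N :=
  moduleGrade_congr (LinearEquiv.ofTop _ (torsionPart_eq_top_iff.mpr h))

lemma IsTorsionOverRegular.quotient {M : Type u} [AddCommGroup M] [Module A M]
    (h : IsTorsionOverRegular A M) (N : Submodule A M) : IsTorsionOverRegular A (M ⧸ N) := by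
  intro f
  ext x
  exact LinearMap.congr_fun (h (f ∘ₗ N.mkQ)) x

lemma infGradeTorsion_le (M : Type u) [AddCommGroup M] [Module A M] [Module.Finite A M] :
    infGradeTorsion A ≤ moduleGrade A (torsionPart A M) :=
  iInf₂_le (ModuleCat.of A M) ‹_›

lemma isTorsionOverRegular_torsionPart (h : 2 ≤ infGradeTorsion A) (M : Type u) [AddCommGroup M]
    [Module A M] [Module.Finite A M] : IsTorsionOverRegular A (torsionPart A M) :=
  subsingleton_ext_zero_iff.mp <| subsingleton_ext_of_lt_moduleGrade <|
    lt_of_lt_of_le (by norm_num) (h.trans (infGradeTorsion_le M))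

/-- If all `t(M)` have grade at least two, the torsion class is closed under submodules: a map
`N → A` extends to `M` because `M ⧸ N` is torsion, hence has `Ext¹(M ⧸ N, A) = 0`. -/
lemma IsTorsionOverRegular.submodule (h : 2 ≤ infGradeTorsion A) {M : Type u} [AddCommGroup M]
    [Module A M] [Module.Finite A M] (hM : IsTorsionOverRegular A M) (N : Submodule A M) :
    IsTorsionOverRegular A N := by
  intro f
  have hQ := hM.quotient N
  have hext : Subsingleton (Ext (ModuleCat.of A (M ⧸ N)) (ModuleCat.of A A) 1) := by
    refine subsingleton_ext_of_lt_moduleGrade (lt_of_lt_of_le (by norm_num) (h.trans ?_))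
    rw [← hQ.moduleGrade_torsionPart]
    exact infGradeTorsion_le _
  obtain ⟨g, rfl⟩ := exists_extension_of_subsingleton_ext_one N hext f
  rw [hM g, LinearMap.zero_comp]

/-- Ext vanishing passes from the torsion simple modules to all torsion modules of finite length,
since all composition factors of a torsion module are torsion. -/
lemma subsingleton_ext_of_forall_simple [IsNoetherianRing A] (h : 2 ≤ infGradeTorsion A) (n : ℕ)
    (hS : ∀ (S : Type u) [AddCommGroup S] [Module A S], IsSimpleModule A S →
      IsTorsionOverRegular A S → Subsingleton (Ext (ModuleCat.of A S) (ModuleCat.of A A) n))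
    {M : Type u} [AddCommGroup M] [Module A M] (hM : IsFiniteLength A M)
    (ht : IsTorsionOverRegular A M) :
    Subsingleton (Ext (ModuleCat.of A M) (ModuleCat.of A A) n) := by
  induction hM with
  | of_subsingleton => exact subsingleton_ext_of_subsingleton _ _ _
  | @of_simple_quotient M _ _ N hsimple hN ih =>
    have hfin : Module.Finite A M := by
      have := (isFiniteLength_iff_isNoetherian_isArtinian.mp
        (IsFiniteLength.of_simple_quotient (N := N) hN)).1
      infer_instance
    exact subsingleton_ext_of_submodule_of_quotient N _ n (ih (ht.submodule h N))
      (hS _ hsimple (ht.quotient N))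

lemma infGradeTorsionSimple_le_of_nontrivial_ext {S : Type u} [AddCommGroup S] [Module A S]
    (hS : IsSimpleModule A S) (ht : IsTorsionOverRegular A S) {n : ℕ}
    (hn : Nontrivial (Ext (ModuleCat.of A S) (ModuleCat.of A A) n)) :
    infGradeTorsionSimple A ≤ n :=
  calc infGradeTorsionSimple A ≤ moduleGrade A (torsionPart A S) := iInf₂_le (ModuleCat.of A S) hS
    _ = moduleGrade A S := ht.moduleGrade_torsionPart
    _ ≤ n := moduleGrade_le hn

/-- A simple module whose torsion part has a non-zero Ext group is itself torsion, so only the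
torsion simple modules contribute to `infGradeTorsionSimple`. -/
lemma le_infGradeTorsionSimple {c : ℕ∞}
    (h : ∀ (S : Type u) [AddCommGroup S] [Module A S], IsSimpleModule A S →
      IsTorsionOverRegular A S → ∀ n : ℕ,
        Nontrivial (Ext (ModuleCat.of A S) (ModuleCat.of A A) n) → c ≤ n) :
    c ≤ infGradeTorsionSimple A := by
  refine le_iInf₂ fun S hS => le_moduleGrade fun n hn => ?_
  have htop : torsionPart A S = ⊤ := by
    refine (eq_bot_or_eq_top _).resolve_left fun hbot => ?_
    have : Subsingleton (torsionPart A S) := by rw [hbot]; infer_instance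
    have := subsingleton_ext_of_subsingleton (A := A) (torsionPart A S) (ModuleCat.of A A) n
    exact not_nontrivial _ hn
  exact h S hS (torsionPart_eq_top_iff.mp htop) n
    (nontrivial_ext_of_linearEquiv (LinearEquiv.ofTop _ htop) _ n hn)

theorem infGradeTorsion_eq_infGradeTorsionSimple [IsArtinianRing A] (h : 2 ≤ infGradeTorsion A) :
    infGradeTorsion A = infGradeTorsionSimple A := by
  apply le_antisymm
  · exact le_iInf₂ fun S hS => infGradeTorsion_le S
  · refine le_iInf₂ fun M hM => le_moduleGrade fun n hn => ?_
    by_contra hlt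
    have : Subsingleton (Ext (ModuleCat.of A (torsionPart A M)) (ModuleCat.of A A) n) := by
      refine subsingleton_ext_of_forall_simple h n (fun S _ _ hS ht => ?_)
        (isFiniteLength_iff_isNoetherian_isArtinian.mpr ⟨inferInstance, inferInstance⟩)
        (isTorsionOverRegular_torsionPart h M)
      by_contra hne
      exact hlt (infGradeTorsionSimple_le_of_nontrivial_ext hS ht
        (not_subsingleton_iff_nontrivial.mp hne))
    exact not_nontrivial _ hn

end TorsionModules

/-! ### Descent along surjections -/

lemma exists_comp_eq_of_ker_le {R X Y Z : Type*} [Ring R] [AddCommGroup X] [Module R X]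
    [AddCommGroup Y] [Module R Y] [AddCommGroup Z] [Module R Z] (p : X →ₗ[R] Y)
    (hp : Function.Surjective p) (f : X →ₗ[R] Z) (h : ∀ x, p x = 0 → f x = 0) :
    ∃ g : Y →ₗ[R] Z, ∀ x, g (p x) = f x := by
  refine ⟨(LinearMap.ker p).liftQ f h ∘ₗ (p.quotKerEquivOfSurjective hp).symm.toLinearMap,
    fun x => ?_⟩
  have : (p.quotKerEquivOfSurjective hp).symm (p x) = (LinearMap.ker p).mkQ x := by
    rw [LinearEquiv.symm_apply_eq]; rfl
  rw [LinearMap.comp_apply, LinearEquiv.coe_coe, this]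
  rfl

lemma nonempty_linearEquiv_of_surjective_of_ker_iff {R X Y Z : Type*} [Ring R] [AddCommGroup X]
    [Module R X] [AddCommGroup Y] [Module R Y] [AddCommGroup Z] [Module R Z] (p : X →ₗ[R] Y)
    (hp : Function.Surjective p) (q : X →ₗ[R] Z) (hq : Function.Surjective q)
    (h : ∀ x, p x = 0 ↔ q x = 0) : Nonempty (Y ≃ₗ[R] Z) :=
  ⟨(p.quotKerEquivOfSurjective hp).symm ≪≫ₗ
    Submodule.quotEquivOfEq (LinearMap.ker p) (LinearMap.ker q) (Submodule.ext h) ≪≫ₗ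
    q.quotKerEquivOfSurjective hq⟩

/-! ### Free right modules and adjoint maps -/

section FreeRightModules

variable {A : Type u} [Ring A]

/-- The map of right modules `Aⁿ → Y` sending the standard basis to `y`. -/
def rightCombination {n : ℕ} {Y : Type*} [AddCommGroup Y] [Module Aᵐᵒᵖ Y] (y : Fin n → Y) :
    (Fin n → A) →ₗ[Aᵐᵒᵖ] Y where
  toFun p := ∑ i, op (p i) • y i
  map_add' p q := by simp [add_smul, Finset.sum_add_distrib]
  map_smul' a p := by simp [Finset.smul_sum, mul_smul]

lemma rightCombination_apply {n : ℕ} {Y : Type*} [AddCommGroup Y] [Module Aᵐᵒᵖ Y] (y : Fin n → Y)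
    (p : Fin n → A) : rightCombination y p = ∑ i, op (p i) • y i := rfl

lemma rightCombination_single {n : ℕ} {Y : Type*} [AddCommGroup Y] [Module Aᵐᵒᵖ Y] (y : Fin n → Y)
    (i : Fin n) : rightCombination y (Pi.single i (1 : A)) = y i := by
  rw [rightCombination_apply, Finset.sum_eq_single i] <;> simp +contextual

lemma eq_rightCombination {n : ℕ} {Y : Type*} [AddCommGroup Y] [Module Aᵐᵒᵖ Y]
    (f : (Fin n → A) →ₗ[Aᵐᵒᵖ] Y) : f = rightCombination fun i => f (Pi.single i 1) := by
  refine LinearMap.ext fun p => ?_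
  have hp : p = ∑ i, op (p i) • (Pi.single i (1 : A) : Fin n → A) := by
    ext j
    simp [Finset.sum_apply, Pi.single_apply]
  conv_lhs => rw [hp]
  simp [rightCombination_apply]

lemma projective_rightModule_pi (n : ℕ) : Module.Projective Aᵐᵒᵖ (Fin n → A) := by
  refine Module.Projective.of_lifting_property'' fun f hf => ?_
  choose y hy using hf
  refine ⟨rightCombination fun i => y (Pi.single i 1), ?_⟩
  rw [eq_rightCombination (f ∘ₗ rightCombination fun i => y (Pi.single i 1)),
    eq_rightCombination (LinearMap.id (R := Aᵐᵒᵖ) (M := Fin n → A))]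
  simp [rightCombination_single, hy]

lemma finite_rightModule_pi (n : ℕ) : Module.Finite Aᵐᵒᵖ (Fin n → A) :=
  Module.Finite.equiv
    (LinearEquiv.piCongrRight fun _ : Fin n => (MulOpposite.opLinearEquiv Aᵐᵒᵖ).symm)

lemma isNoetherian_rightModule_pi [IsNoetherianRing Aᵐᵒᵖ] (n : ℕ) :
    IsNoetherian Aᵐᵒᵖ (Fin n → A) :=
  have := finite_rightModule_pi (A := A) n
  isNoetherian_of_isNoetherianRing_of_finite Aᵐᵒᵖ _

lemma exists_rightCombination_surjective (Y : Type*) [AddCommGroup Y] [Module Aᵐᵒᵖ Y]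
    [Module.Finite Aᵐᵒᵖ Y] :
    ∃ (n : ℕ) (π : (Fin n → A) →ₗ[Aᵐᵒᵖ] Y), Function.Surjective π := by
  obtain ⟨n, y, hy⟩ := Module.Finite.exists_fin (R := Aᵐᵒᵖ) (M := Y)
  refine ⟨n, rightCombination y, fun z => ?_⟩
  obtain ⟨c, rfl⟩ := (Submodule.mem_span_range_iff_exists_fun Aᵐᵒᵖ).mp
    (hy ▸ Submodule.mem_top : z ∈ _)
  exact ⟨fun i => unop (c i), by simp [rightCombination_apply]⟩

lemma rightLinear_eq_dotProduct {n : ℕ} (φ : (Fin n → A) →ₗ[Aᵐᵒᵖ] A) (p : Fin n → A) :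
    φ p = (fun i => φ (Pi.single i 1)) ⬝ᵥ p := by
  conv_lhs => rw [eq_rightCombination φ]
  simp [rightCombination_apply, dotProduct]

lemma leftLinear_eq_dotProduct {n : ℕ} (θ : (Fin n → A) →ₗ[A] A) (q : Fin n → A) :
    θ q = q ⬝ᵥ fun i => θ (Pi.single i 1) := by
  have hq : q = ∑ i, q i • (Pi.single i (1 : A) : Fin n → A) := by
    ext j
    simp [Finset.sum_apply, Pi.single_apply]
  conv_lhs => rw [hq]
  simp [dotProduct]

/-- The dot product `q ↦ q · p` as a map of left modules. -/
def dotProductLeft {n : ℕ} (p : Fin n → A) : (Fin n → A) →ₗ[A] A where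
  toFun q := q ⬝ᵥ p
  map_add' _ _ := add_dotProduct _ _ _
  map_smul' _ _ := smul_dotProduct _ _ _

/-- The dot product `p ↦ q · p` as a map of right modules. -/
def dotProductRight {n : ℕ} (q : Fin n → A) : (Fin n → A) →ₗ[Aᵐᵒᵖ] A where
  toFun p := q ⬝ᵥ p
  map_add' _ _ := dotProduct_add _ _ _
  map_smul' _ _ := dotProduct_smul _ _ _

lemma exists_left_adjoint {m n : ℕ} (f : (Fin m → A) →ₗ[Aᵐᵒᵖ] (Fin n → A)) :
    ∃ g : (Fin n → A) →ₗ[A] (Fin m → A), ∀ q p, q ⬝ᵥ f p = g q ⬝ᵥ p :=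
  ⟨LinearMap.pi fun j => dotProductLeft (f (Pi.single j 1)), fun q p =>
    rightLinear_eq_dotProduct (dotProductRight q ∘ₗ f) p⟩

lemma exists_right_adjoint {m n : ℕ} (g : (Fin n → A) →ₗ[A] (Fin m → A)) :
    ∃ f : (Fin m → A) →ₗ[Aᵐᵒᵖ] (Fin n → A), ∀ q p, q ⬝ᵥ f p = g q ⬝ᵥ p :=
  ⟨LinearMap.pi fun i => dotProductRight (g (Pi.single i 1)), fun q p =>
    (leftLinear_eq_dotProduct (dotProductLeft p ∘ₗ g) q).symm⟩

end FreeRightModules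

/-! ### The left modules Ext(-, A) -/

section RegularExtModules

variable {A : Type u} [Ring A]

lemma RegularExt.smul_def {M : ModuleCat.{u} Aᵐᵒᵖ} {i : ℕ} (a : A) (e : RegularExt M i) :
    a • e = Ext.comp (Z := ModuleCat.of Aᵐᵒᵖ A) (show Ext _ _ i from e)
      (Ext.mk₀ (leftMulHom a)) (add_zero i) := rfl

/-- The connecting map `Extⁱ(X₁, A) → Extⁱ⁺¹(X₃, A)` of a short exact sequence of right modules,
as a map of left modules. -/
def regularExtConnecting {S : ShortComplex (ModuleCat.{u} Aᵐᵒᵖ)} (hS : S.ShortExact) {i j : ℕ}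
    (h : 1 + i = j) : RegularExt S.X₁ i →ₗ[A] RegularExt S.X₃ j where
  toFun e := hS.extClass.comp (show Ext _ _ i from e) h
  map_add' e f := Ext.comp_add ..
  map_smul' a e := by
    simp only [RegularExt.smul_def]
    exact (Ext.comp_assoc_of_third_deg_zero ..).symm

lemma regularExtConnecting_surjective {S : ShortComplex (ModuleCat.{u} Aᵐᵒᵖ)} (hS : S.ShortExact)
    [Projective S.X₂] {i j : ℕ} (h : 1 + i = j) :
    Function.Surjective (regularExtConnecting hS h) := by
  intro x
  obtain rfl : j = i + 1 := by omega
  obtain ⟨y, hy⟩ := Ext.contravariant_sequence_exact₃ hS (ModuleCat.of Aᵐᵒᵖ A) x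
    (Ext.eq_zero_of_projective _) h
  exact ⟨y, hy⟩

lemma regularExtConnecting_injective {S : ShortComplex (ModuleCat.{u} Aᵐᵒᵖ)} (hS : S.ShortExact)
    [Projective S.X₂] {i j : ℕ} (h : 1 + (i + 1) = j) :
    Function.Injective (regularExtConnecting hS h) := by
  rw [injective_iff_map_eq_zero]
  intro x hx
  obtain ⟨y, hy⟩ := Ext.contravariant_sequence_exact₁ hS (ModuleCat.of Aᵐᵒᵖ A) x h hx
  rw [← hy, Ext.eq_zero_of_projective y]
  exact Ext.comp_zero ..

/-- `Hom(K, A) → Ext⁰(K, A)` as a map of left modules. -/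
def homToRegularExtZero (K : Type u) [AddCommGroup K] [Module Aᵐᵒᵖ K] :
    (K →ₗ[Aᵐᵒᵖ] A) →ₗ[A] RegularExt (ModuleCat.of Aᵐᵒᵖ K) 0 where
  toFun φ := (Ext.mk₀ (ModuleCat.ofHom φ) : Ext _ (ModuleCat.of Aᵐᵒᵖ A) 0)
  map_add' φ ψ := Ext.mk₀_add _ _
  map_smul' a φ := by
    refine Eq.trans ?_ (RegularExt.smul_def a _).symm
    exact (Ext.mk₀_comp_mk₀ (ModuleCat.ofHom φ) (leftMulHom a)).symm

lemma homToRegularExtZero_surjective (K : Type u) [AddCommGroup K] [Module Aᵐᵒᵖ K] :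
    Function.Surjective (homToRegularExtZero (A := A) K) := fun x => by
  obtain ⟨g, hg⟩ := (Ext.mk₀_bijective (ModuleCat.of Aᵐᵒᵖ K) (ModuleCat.of Aᵐᵒᵖ A)).2 x
  exact ⟨g.hom, hg⟩

lemma shortExact_ker_of_surjective {X Y : Type u} [AddCommGroup X] [Module Aᵐᵒᵖ X]
    [AddCommGroup Y] [Module Aᵐᵒᵖ Y] (π : X →ₗ[Aᵐᵒᵖ] Y) (hπ : Function.Surjective π) :
    (ShortComplex.mk (ModuleCat.ofHom (LinearMap.ker π).subtype) (ModuleCat.ofHom π)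
      (by ext x; exact x.2)).ShortExact :=
  shortExact_of_exact _ _ (Submodule.subtype_injective _) hπ
    (LinearMap.exact_subtype_ker_map π)

/-- Dimension shift: for `i ≥ 1` the left module `Extⁱ(Y, A)` is `Ext¹` of a syzygy of `Y`. -/
lemma exists_regularExt_linearEquiv_regularExt_one [IsNoetherianRing Aᵐᵒᵖ] (i : ℕ) :
    ∀ (Y : ModuleCat.{u} Aᵐᵒᵖ), Module.Finite Aᵐᵒᵖ Y → ∃ Z : ModuleCat.{u} Aᵐᵒᵖ,
      Module.Finite Aᵐᵒᵖ Z ∧ Nonempty (RegularExt Y (i + 1) ≃ₗ[A] RegularExt Z 1) := by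
  induction i with
  | zero => exact fun Y hY => ⟨Y, hY, ⟨LinearEquiv.refl _ _⟩⟩
  | succ i ih =>
    intro Y hY
    obtain ⟨n, π, hπ⟩ := exists_rightCombination_surjective (A := A) Y
    have := isNoetherian_rightModule_pi (A := A) n
    have hS := shortExact_ker_of_surjective π hπ
    have : Projective (ModuleCat.of Aᵐᵒᵖ (Fin n → A)) :=
      (IsProjective.iff_projective _).mp (projective_rightModule_pi n)
    obtain ⟨Z, hZ, ⟨e⟩⟩ := ih (ModuleCat.of Aᵐᵒᵖ (LinearMap.ker π)) inferInstance
    exact ⟨Z, hZ, ⟨(LinearEquiv.ofBijective (regularExtConnecting hS (add_comm 1 (i + 1)))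
      ⟨regularExtConnecting_injective hS _, regularExtConnecting_surjective hS _⟩).symm ≪≫ₗ e⟩⟩

end RegularExtModules

/-! ### Torsion as Ext¹ of the transpose -/

section Transpose

variable {A : Type u} [Ring A]

/-- The Auslander–Bridger description of torsion: if `Y` and `M` are the cokernels of adjoint maps
`f : Aᵐ → Aⁿ` (right modules) and `g : Aⁿ → Aᵐ` (left modules), then `Ext¹(Y, A) ≅ t(M)`. With
`K = range f ⊆ Aⁿ`, both sides are the quotient of `Hom(K, A)` by the maps that extend to `Aⁿ`:
a map `φ` on `K` corresponds to the vector `q` with `q · p = φ (f p)`, and the torsion elements of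
`M` are the classes of those `q` with `q · p = 0` for all `p` in the kernel of `f`. -/
lemma nonempty_regularExt_one_linearEquiv_torsionPart {m n : ℕ}
    (f : (Fin m → A) →ₗ[Aᵐᵒᵖ] (Fin n → A)) (g : (Fin n → A) →ₗ[A] (Fin m → A))
    (hfg : ∀ q p, q ⬝ᵥ f p = g q ⬝ᵥ p)
    {Y M : Type u} [AddCommGroup Y] [Module Aᵐᵒᵖ Y] [AddCommGroup M] [Module A M]
    (π : (Fin n → A) →ₗ[Aᵐᵒᵖ] Y) (hπ : Function.Surjective π) (hfπ : Function.Exact f π)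
    (ρ : (Fin m → A) →ₗ[A] M) (hρ : Function.Surjective ρ) (hgρ : Function.Exact g ρ) :
    Nonempty (RegularExt (ModuleCat.of Aᵐᵒᵖ Y) 1 ≃ₗ[A] torsionPart A M) := by
  let f' : (Fin m → A) →ₗ[Aᵐᵒᵖ] LinearMap.ker π :=
    f.codRestrict _ fun p => hfπ.apply_apply_eq_zero p
  have hf' : Function.Surjective f' := by
    rintro ⟨y, hy⟩
    obtain ⟨p, rfl⟩ := (hfπ y).mp hy
    exact ⟨p, rfl⟩
  have hS := shortExact_ker_of_surjective π hπ
  have : Projective (ModuleCat.of Aᵐᵒᵖ (Fin n → A)) :=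
    (IsProjective.iff_projective _).mp (projective_rightModule_pi n)
  let coords : (LinearMap.ker π →ₗ[Aᵐᵒᵖ] A) →ₗ[A] (Fin m → A) :=
    { toFun := fun φ j => φ (f' (Pi.single j 1))
      map_add' := fun _ _ => rfl
      map_smul' := fun _ _ => rfl }
  have hcoords (φ : LinearMap.ker π →ₗ[Aᵐᵒᵖ] A) (p : Fin m → A) : coords φ ⬝ᵥ p = φ (f' p) :=
    (rightLinear_eq_dotProduct (φ ∘ₗ f') p).symm
  -- A vector is determined by its dot products with the standard basis.
  have hdot {l : ℕ} {x y : Fin l → A} (h : ∀ p : Fin l → A, x ⬝ᵥ p = y ⬝ᵥ p) : x = y := by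
    ext j
    simpa using h (Pi.single j 1)
  have hmem (φ : LinearMap.ker π →ₗ[Aᵐᵒᵖ] A) : (ρ ∘ₗ coords) φ ∈ torsionPart A M := by
    refine mem_torsionPart_iff.mpr fun θ => ?_
    set p : Fin m → A := fun j => θ (ρ (Pi.single j 1)) with hp
    have hθ (q : Fin m → A) : θ (ρ q) = q ⬝ᵥ p := leftLinear_eq_dotProduct (θ ∘ₗ ρ) q
    have hfp : f p = 0 := by
      ext i
      have := hfg (Pi.single i 1) p
      rw [← hθ, hgρ.apply_apply_eq_zero, map_zero, single_dotProduct, one_mul] at this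
      exact this
    have hf'p : f' p = 0 := Subtype.ext hfp
    rw [LinearMap.comp_apply, hθ, hcoords, hf'p, map_zero]
  let α : (LinearMap.ker π →ₗ[Aᵐᵒᵖ] A) →ₗ[A] torsionPart A M :=
    (ρ ∘ₗ coords).codRestrict _ hmem
  have hα : Function.Surjective α := by
    rintro ⟨x, hx⟩
    obtain ⟨q, rfl⟩ := hρ x
    have hker (p : Fin m → A) (hp : f' p = 0) : dotProductRight q p = 0 := by
      obtain ⟨θ, hθ⟩ := exists_comp_eq_of_ker_le ρ hρ (dotProductLeft p) fun z hz => by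
        obtain ⟨w, rfl⟩ := (hgρ z).mp hz
        have hfp : f p = 0 := congrArg Subtype.val hp
        exact (hfg w p).symm.trans (by rw [hfp, dotProduct_zero])
      exact (hθ q).symm.trans (mem_torsionPart_iff.mp hx θ)
    obtain ⟨φ, hφ⟩ := exists_comp_eq_of_ker_le f' hf' (dotProductRight q) hker
    refine ⟨φ, Subtype.ext (congrArg ρ (hdot fun p => ?_))⟩
    exact (hcoords φ p).trans (hφ p)
  let β : (LinearMap.ker π →ₗ[Aᵐᵒᵖ] A) →ₗ[A] RegularExt (ModuleCat.of Aᵐᵒᵖ Y) 1 :=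
    regularExtConnecting hS (add_zero 1) ∘ₗ homToRegularExtZero _
  have hβ : Function.Surjective β :=
    (regularExtConnecting_surjective hS (add_zero 1)).comp (homToRegularExtZero_surjective _)
  have hβ0 (φ : LinearMap.ker π →ₗ[Aᵐᵒᵖ] A) :
      β φ = 0 ↔ ∃ ψ : (Fin n → A) →ₗ[Aᵐᵒᵖ] A, ψ ∘ₗ (LinearMap.ker π).subtype = φ := by
    constructor
    · intro h
      obtain ⟨y, hy⟩ := Ext.contravariant_sequence_exact₁ hS (ModuleCat.of Aᵐᵒᵖ A)
        (Ext.mk₀ (ModuleCat.ofHom φ)) (add_zero 1) h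
      obtain ⟨ψ, rfl⟩ := (Ext.mk₀_bijective _ _).2 y
      refine ⟨ψ.hom, ?_⟩
      rw [Ext.mk₀_comp_mk₀] at hy
      exact congrArg ModuleCat.Hom.hom ((Ext.mk₀_bijective _ _).1 hy)
    · rintro ⟨ψ, rfl⟩
      have h : hS.extClass.comp ((Ext.mk₀ (ModuleCat.ofHom (LinearMap.ker π).subtype)).comp
          (Ext.mk₀ (ModuleCat.ofHom ψ)) (zero_add 0)) (add_zero 1) = 0 :=
        hS.extClass_comp_assoc _
      rw [Ext.mk₀_comp_mk₀] at h
      exact h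
  have hα0 (φ : LinearMap.ker π →ₗ[Aᵐᵒᵖ] A) :
      α φ = 0 ↔ ∃ ψ : (Fin n → A) →ₗ[Aᵐᵒᵖ] A, ψ ∘ₗ (LinearMap.ker π).subtype = φ := by
    constructor
    · intro h
      obtain ⟨q, hq⟩ := (hgρ (coords φ)).mp (congrArg Subtype.val h)
      refine ⟨dotProductRight q, LinearMap.ext fun z => ?_⟩
      obtain ⟨p, rfl⟩ := hf' z
      exact (hfg q p).trans ((congrArg (· ⬝ᵥ p) hq).trans (hcoords φ p))
    · rintro ⟨ψ, rfl⟩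
      refine Subtype.ext ((hgρ _).mpr ⟨fun i => ψ (Pi.single i 1), hdot fun p => ?_⟩)
      rw [← hfg, hcoords]
      exact (rightLinear_eq_dotProduct ψ (f p)).symm
  exact nonempty_linearEquiv_of_surjective_of_ker_iff β hβ α hα
    fun φ => (hβ0 φ).trans (hα0 φ).symm

/-- Every finitely generated left module `M` has `t(M) ≅ Ext¹(Y, A)` for some finitely generated
right module `Y`. -/
lemma exists_regularExt_one_linearEquiv_torsionPart [IsNoetherianRing A] (M : Type u)
    [AddCommGroup M] [Module A M] [Module.Finite A M] :
    ∃ Y : ModuleCat.{u} Aᵐᵒᵖ, Module.Finite Aᵐᵒᵖ Y ∧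
      Nonempty (RegularExt Y 1 ≃ₗ[A] torsionPart A M) := by
  obtain ⟨m, ρ, hρ⟩ := Module.Finite.exists_fin' A M
  obtain ⟨n, σ, hσ⟩ := Module.Finite.exists_fin' A (LinearMap.ker ρ)
  obtain ⟨f, hf⟩ := exists_right_adjoint ((LinearMap.ker ρ).subtype ∘ₗ σ)
  have := finite_rightModule_pi (A := A) n
  refine ⟨ModuleCat.of Aᵐᵒᵖ ((Fin n → A) ⧸ LinearMap.range f),
    inferInstanceAs (Module.Finite Aᵐᵒᵖ ((Fin n → A) ⧸ LinearMap.range f)),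
    nonempty_regularExt_one_linearEquiv_torsionPart f _ hf (LinearMap.range f).mkQ
      (Submodule.mkQ_surjective _) (LinearMap.exact_map_mkQ_range f) ρ hρ ?_⟩
  rw [LinearMap.exact_iff, LinearMap.range_comp_of_range_eq_top _ (LinearMap.range_eq_top.mpr hσ),
    Submodule.range_subtype]

/-- Every finitely generated right module `Y` has `Ext¹(Y, A) ≅ t(M)` for some finitely generated
left module `M`. -/
lemma exists_torsionPart_linearEquiv_regularExt_one [IsNoetherianRing Aᵐᵒᵖ]
    (Y : ModuleCat.{u} Aᵐᵒᵖ) [Module.Finite Aᵐᵒᵖ Y] :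
    ∃ M : ModuleCat.{u} A, Module.Finite A M ∧
      Nonempty (RegularExt Y 1 ≃ₗ[A] torsionPart A M) := by
  obtain ⟨n, π, hπ⟩ := exists_rightCombination_surjective (A := A) Y
  have := isNoetherian_rightModule_pi (A := A) n
  obtain ⟨m, σ, hσ⟩ := exists_rightCombination_surjective (A := A) (LinearMap.ker π)
  obtain ⟨g, hg⟩ := exists_left_adjoint ((LinearMap.ker π).subtype ∘ₗ σ)
  refine ⟨ModuleCat.of A ((Fin m → A) ⧸ LinearMap.range g),
    inferInstanceAs (Module.Finite A ((Fin m → A) ⧸ LinearMap.range g)),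
    nonempty_regularExt_one_linearEquiv_torsionPart _ g hg π hπ ?_ (LinearMap.range g).mkQ
      (Submodule.mkQ_surjective _) (LinearMap.exact_map_mkQ_range g)⟩
  rw [LinearMap.exact_iff, LinearMap.range_comp_of_range_eq_top _ (LinearMap.range_eq_top.mpr hσ),
    Submodule.range_subtype]

theorem infGradeExt_eq_infGradeTorsion [IsNoetherianRing A] [IsNoetherianRing Aᵐᵒᵖ] :
    infGradeExt A = infGradeTorsion A := by
  apply le_antisymm
  · refine le_iInf₂ fun M hM => ?_
    obtain ⟨Y, hY, ⟨e⟩⟩ := exists_regularExt_one_linearEquiv_torsionPart (A := A) M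
    rw [← moduleGrade_congr e]
    exact (iInf₂_le Y hY).trans (iInf₂_le 1 le_rfl)
  · refine le_iInf₂ fun Y hY => le_iInf₂ fun i hi => ?_
    obtain ⟨i, rfl⟩ := Nat.exists_eq_add_of_le' hi
    obtain ⟨Z, hZ, ⟨e⟩⟩ := exists_regularExt_linearEquiv_regularExt_one i Y hY
    obtain ⟨M, hM, ⟨e'⟩⟩ := exists_torsionPart_linearEquiv_regularExt_one Z
    rw [moduleGrade_congr (e ≪≫ₗ e')]
    exact infGradeTorsion_le M

end Transpose

/-! ### Finitely generated injective modules over a finite-dimensional algebra -/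

section Coinduced

variable (k : Type v) [Field k] (A : Type u) [Ring A] [Algebra k A]
  (M : Type u) [AddCommGroup M] [Module k M]

/-- The coinduced left `A`-module `Hom_k(A, M)` of a `k`-vector space `M`, with `A` acting through
right multiplication on the argument: `(a • f) x = f (x * a)`. -/
def Coinduced : Type u := A →ₗ[k] M

namespace Coinduced

instance : AddCommGroup (Coinduced k A M) := inferInstanceAs (AddCommGroup (A →ₗ[k] M))

instance : Module k (Coinduced k A M) := inferInstanceAs (Module k (A →ₗ[k] M))

variable {k A M}

/-- An element of the coinduced module as a `k`-linear map. -/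
def toLin (f : Coinduced k A M) : A →ₗ[k] M := f

lemma ext_toLin {f g : Coinduced k A M} (h : ∀ x, f.toLin x = g.toLin x) : f = g :=
  LinearMap.ext (f := f.toLin) (g := g.toLin) h

instance : SMul A (Coinduced k A M) where
  smul a f := f.toLin ∘ₗ LinearMap.mulRight k a

lemma toLin_smul (a : A) (f : Coinduced k A M) (x : A) : (a • f).toLin x = f.toLin (x * a) := rfl

lemma toLin_add (f g : Coinduced k A M) (x : A) : (f + g).toLin x = f.toLin x + g.toLin x := rfl

instance : Module A (Coinduced k A M) where
  one_smul f := ext_toLin fun x => by rw [toLin_smul, mul_one]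
  mul_smul a b f := ext_toLin fun x => by simp only [toLin_smul, mul_assoc]
  smul_zero a := rfl
  smul_add a f g := rfl
  add_smul a b f := ext_toLin fun x => by simp only [toLin_smul, toLin_add, mul_add, map_add]
  zero_smul f := ext_toLin fun x => by rw [toLin_smul, mul_zero, map_zero]; rfl

instance : IsScalarTower k A (Coinduced k A M) where
  smul_assoc c a f := ext_toLin fun x => by
    rw [toLin_smul, mul_smul_comm, map_smul]; rfl

lemma finite [FiniteDimensional k A] [Module.Finite k M] : Module.Finite A (Coinduced k A M) :=
  have : Module.Finite k (Coinduced k A M) := inferInstanceAs (Module.Finite k (A →ₗ[k] M))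
  Module.Finite.of_restrictScalars_finite k A _

/-- Maps into `Hom_k(A, M)` are `k`-linear maps into `M`, and these extend along injections. -/
lemma injective : Module.Injective A (Coinduced k A M) where
  out X Y _ _ _ _ i hi g := by
    let : Module k X := Module.compHom X (algebraMap k A)
    let : Module k Y := Module.compHom Y (algebraMap k A)
    have : IsScalarTower k A X := ⟨fun c a x => by
      rw [Algebra.smul_def, mul_smul]; rfl⟩
    have : IsScalarTower k A Y := ⟨fun c a x => by
      rw [Algebra.smul_def, mul_smul]; rfl⟩
    let g' : X →ₗ[k] M :=
      { toFun := fun x => (g x).toLin 1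
        map_add' := fun x y => by rw [map_add, toLin_add]
        map_smul' := fun c x => by
          rw [← algebraMap_smul A c x, map_smul, toLin_smul, one_mul,
            Algebra.algebraMap_eq_smul_one, map_smul]; rfl }
    obtain ⟨r, hr⟩ := (i.restrictScalars k).exists_leftInverse_of_injective
      (LinearMap.ker_eq_bot.mpr hi)
    have hr' (x : X) : r (i x) = x := LinearMap.congr_fun hr x
    let l : Y → Coinduced k A M := fun y =>
      (g' ∘ₗ r) ∘ₗ ((LinearMap.toSpanSingleton A Y y).restrictScalars k)
    have hl (y : Y) (a : A) : (l y).toLin a = g' (r (a • y)) := rfl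
    refine ⟨{ toFun := l, map_add' := fun y z => ext_toLin fun x => ?_,
              map_smul' := fun a y => ext_toLin fun x => ?_ }, fun x => ext_toLin fun a => ?_⟩
    · rw [toLin_add, hl, hl, hl, smul_add, map_add, map_add]
    · rw [RingHom.id_apply, toLin_smul, hl, hl, mul_smul]
    · change (l (i x)).toLin a = _
      rw [hl, ← map_smul, hr']
      change (g (a • x)).toLin 1 = _
      rw [map_smul, toLin_smul, one_mul]

end Coinduced

variable {A} in
/-- The unit `M → Hom_k(A, M)`, `m ↦ (x ↦ x • m)`, embeds a finitely generated module into a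
finitely generated injective one. -/
lemma exists_finite_injective_embedding [FiniteDimensional k A] (M : Type u) [AddCommGroup M]
    [Module A M] [Module.Finite A M] : ∃ (E : ModuleCat.{u} A) (j : M →ₗ[A] E),
      Module.Finite A E ∧ Module.Injective A E ∧ Function.Injective j := by
  let : Module k M := Module.compHom M (algebraMap k A)
  have : IsScalarTower k A M := ⟨fun c a x => by
    rw [Algebra.smul_def, mul_smul]; rfl⟩
  have : Module.Finite k M := Module.Finite.trans A M
  let l : M → Coinduced k A M := fun m => (LinearMap.toSpanSingleton A M m).restrictScalars k
  have hl (m : M) (a : A) : (l m).toLin a = a • m := rfl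
  refine ⟨ModuleCat.of A (Coinduced k A M),
    { toFun := l
      map_add' := fun y z => Coinduced.ext_toLin fun x => ?_
      map_smul' := fun a y => Coinduced.ext_toLin fun x => ?_ },
    Coinduced.finite, Coinduced.injective, fun m n h => ?_⟩
  · rw [Coinduced.toLin_add, hl, hl, hl, smul_add]
  · rw [RingHom.id_apply, Coinduced.toLin_smul, hl, hl, mul_smul]
  · have h' : l m = l n := h
    simpa [hl] using congrArg (fun f => f.toLin 1) h'

end Coinduced

/-! ### Injective hulls and minimal coresolutions -/

section InjectiveHull

variable {A : Type u} [Ring A]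

lemma injective_of_isCompl {E : Type u} [AddCommGroup E] [Module A E] (hE : Module.Injective A E)
    {p q : Submodule A E} (h : IsCompl p q) : Module.Injective A p where
  out X Y _ _ _ _ i hi g := by
    obtain ⟨l, hl⟩ := hE.out i hi (p.subtype ∘ₗ g)
    refine ⟨p.projectionOnto q h ∘ₗ l, fun x => ?_⟩
    rw [LinearMap.comp_apply, hl]
    exact Submodule.projectionOnto_apply_left h (g x)

lemma IsEssentialSubmodule.injective_of_injective_comp {N I E : Type u} [AddCommGroup N]
    [Module A N] [AddCommGroup I] [Module A I] [AddCommGroup E] [Module A E] {j : N →ₗ[A] I}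
    (h : IsEssentialSubmodule A (LinearMap.range j)) (g : I →ₗ[A] E)
    (hg : Function.Injective (g ∘ₗ j)) : Function.Injective g := by
  rw [← LinearMap.ker_eq_bot]
  refine h _ (eq_bot_iff.mpr ?_)
  rintro _ ⟨⟨x, rfl⟩, hx⟩
  have : x = 0 := hg (by rw [map_zero]; exact hx)
  rw [this, map_zero]; exact zero_mem _

/-- An injective hull of a finitely generated module: among the finitely generated injective modules
containing `M`, one of least length is an essential extension of `M`. Otherwise some non-zero `X`
meets `M` trivially, and an endomorphism that kills `X` and fixes `M` has, by Fitting's lemma, a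
proper direct summand containing `M` as the range of a power. -/
lemma exists_finite_injective_hull (k : Type v) [Field k] [Algebra k A] [FiniteDimensional k A]
    [IsArtinianRing A] (M : Type u) [AddCommGroup M] [Module A M] [Module.Finite A M] :
    ∃ (E : ModuleCat.{u} A) (j : M →ₗ[A] E), Module.Finite A E ∧ Module.Injective A E ∧
      Function.Injective j ∧ IsEssentialSubmodule A (LinearMap.range j) := by
  let s : Set ℕ∞ := {l | ∃ (E : ModuleCat.{u} A) (j : M →ₗ[A] E), Module.Finite A E ∧
    Module.Injective A E ∧ Function.Injective j ∧ Module.length A E = l}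
  have hs : s.Nonempty := by
    obtain ⟨E, j, h₁, h₂, h₃⟩ := exists_finite_injective_embedding k (A := A) M
    exact ⟨_, E, j, h₁, h₂, h₃, rfl⟩
  obtain ⟨_, ⟨E, j, hfin, hinj, hj, rfl⟩, hmin⟩ := wellFounded_lt.has_min s hs
  refine ⟨E, j, hfin, hinj, hj, fun X hX => ?_⟩
  by_contra hX0
  have hq : Function.Injective (X.mkQ ∘ₗ j) := by
    rw [← LinearMap.ker_eq_bot, eq_bot_iff]
    intro m hm
    have hmX : j m ∈ X := (Submodule.Quotient.mk_eq_zero X).mp hm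
    have : j m ∈ LinearMap.range j ⊓ X := ⟨⟨m, rfl⟩, hmX⟩
    rw [hX, Submodule.mem_bot] at this
    exact hj (this.trans (map_zero j).symm)
  obtain ⟨g, hg⟩ := hinj.out (X.mkQ ∘ₗ j) hq j
  let e : Module.End A E := g ∘ₗ X.mkQ
  have hej (m : M) (n : ℕ) : (e ^ n) (j m) = j m := by
    induction n with
    | zero => rfl
    | succ n ih => rw [pow_succ, Module.End.mul_apply, show e (j m) = j m from hg m, ih]
  obtain ⟨n, hc, hn⟩ := (e.eventually_isCompl_ker_pow_range_pow.and
    (Filter.eventually_ge_atTop 1)).exists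
  have hXker : X ≤ LinearMap.ker (e ^ n) := by
    obtain ⟨n, rfl⟩ := Nat.exists_eq_add_of_le' hn
    intro x hx
    have hex : e x = 0 := by
      change g (X.mkQ x) = 0
      rw [Submodule.mkQ_apply, (Submodule.Quotient.mk_eq_zero X).mpr hx, map_zero]
    rw [LinearMap.mem_ker, pow_succ, Module.End.mul_apply, hex, map_zero]
  have htop : LinearMap.range (e ^ n) ≠ ⊤ := fun htop => by
    have := hc.disjoint.eq_bot
    rw [htop, inf_top_eq] at this
    exact hX0 (eq_bot_iff.mpr (this ▸ hXker))
  refine hmin _ ⟨ModuleCat.of A (LinearMap.range (e ^ n)),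
    j.codRestrict _ fun m => ⟨j m, hej m n⟩,
    inferInstanceAs (Module.Finite A (LinearMap.range (e ^ n))),
    injective_of_isCompl hinj hc.symm, fun x y hxy => hj (congrArg Subtype.val hxy), rfl⟩
    (Submodule.length_lt htop)

variable (A) in
/-- Finitely generated modules have minimal injective coresolutions: iterate the injective hull of
the cokernel. -/
lemma nonempty_minimalInjectiveCoresolution (k : Type v) [Field k] [Algebra k A]
    [FiniteDimensional k A] [IsArtinianRing A] (M : Type u) [AddCommGroup M] [Module A M]
    [Module.Finite A M] : Nonempty (MinimalInjectiveCoresolution A M) := by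
  have hull (N : {N : ModuleCat.{u} A // Module.Finite A N}) :=
    have := N.2
    exists_finite_injective_hull k (A := A) N.1
  choose E j hfin hinj hj hess using hull
  let next (N : {N : ModuleCat.{u} A // Module.Finite A N}) :
      {N : ModuleCat.{u} A // Module.Finite A N} :=
    ⟨ModuleCat.of A (E N ⧸ LinearMap.range (j N)),
      have := hfin N
      inferInstanceAs (Module.Finite A (E N ⧸ LinearMap.range (j N)))⟩
  let N (n : ℕ) : {N : ModuleCat.{u} A // Module.Finite A N} :=
    Nat.rec ⟨ModuleCat.of A M, ‹_›⟩ (fun _ => next) n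
  let q (n : ℕ) : E (N n) →ₗ[A] (N (n + 1)).1 := (LinearMap.range (j (N n))).mkQ
  have hq (n : ℕ) : Function.Exact (j (N n)) (q n) := LinearMap.exact_map_mkQ_range _
  have hq' (n : ℕ) : Function.Surjective (q n) := Submodule.mkQ_surjective _
  have hd (n : ℕ) : Function.Exact (j (N n)) (j (N (n + 1)) ∘ₗ q n) :=
    (hq n).comp_injective _ (hj (N (n + 1))) (map_zero (j (N (n + 1))))
  have hrange (n : ℕ) : LinearMap.range (j (N (n + 1)) ∘ₗ q n) = LinearMap.range (j (N (n + 1))) :=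
    LinearMap.range_comp_of_range_eq_top _ (LinearMap.range_eq_top.mpr (hq' n))
  exact ⟨{
    I := fun n => E (N n)
    ι := j (N 0)
    d := fun n => j (N (n + 1)) ∘ₗ q n
    injective := fun n => hinj _
    ι_injective := hj _
    exact_zero := hd 0
    exact_succ := fun n => by
      rw [LinearMap.exact_iff, hrange]
      exact LinearMap.exact_iff.mp (hd (n + 1))
    essential_zero := hess _
    essential_succ := fun n => by
      rw [hrange]
      exact hess _ }⟩

end InjectiveHull

/-! ### Ext from simple modules and minimal coresolutions -/

section Coresolution

variable {A : Type u} [Ring A]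

lemma subsingleton_ext_congr_right (X : ModuleCat.{u} A) {Y Y' : Type u} [AddCommGroup Y]
    [Module A Y] [AddCommGroup Y'] [Module A Y'] (e : Y ≃ₗ[A] Y') (n : ℕ) :
    Subsingleton (Ext X (ModuleCat.of A Y) n) ↔ Subsingleton (Ext X (ModuleCat.of A Y') n) := by
  have key {Y Y' : Type u} [AddCommGroup Y] [Module A Y] [AddCommGroup Y'] [Module A Y']
      (e : Y ≃ₗ[A] Y') (h : Subsingleton (Ext X (ModuleCat.of A Y) n)) :
      Subsingleton (Ext X (ModuleCat.of A Y') n) := by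
    refine subsingleton_of_forall_eq 0 fun x => ?_
    rw [← Ext.comp_mk₀_id x, ← e.toModuleIso.inv_hom_id, ← Ext.mk₀_comp_mk₀,
      ← Ext.comp_assoc_of_third_deg_zero,
      Subsingleton.elim (x.comp (Ext.mk₀ e.toModuleIso.inv) (add_zero n)) 0, Ext.zero_comp]
  exact ⟨key e, key e.symm⟩

/-- An essential submodule contains the image of every map from a simple module. -/
lemma IsEssentialSubmodule.apply_mem_of_isSimpleModule {I S : Type u} [AddCommGroup I] [Module A I]
    [AddCommGroup S] [Module A S] [IsSimpleModule A S] {N : Submodule A I}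
    (h : IsEssentialSubmodule A N) (f : S →ₗ[A] I) (x : S) : f x ∈ N := by
  rcases eq_bot_or_eq_top (N.comap f) with hN | hN
  · have hf : LinearMap.range f = ⊥ := by
      refine h _ (eq_bot_iff.mpr ?_)
      rintro _ ⟨hy, ⟨y, rfl⟩⟩
      have hy' : y ∈ N.comap f := hy
      rw [hN, Submodule.mem_bot] at hy'
      rw [hy', map_zero]
      exact zero_mem _
    rw [LinearMap.range_eq_bot.mp hf, LinearMap.zero_apply]
    exact zero_mem _
  · have : x ∈ N.comap f := hN ▸ Submodule.mem_top
    exact this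

/-- An essential injective extension of a finitely generated module is finitely generated, because
it embeds in every injective module containing that module. -/
lemma IsEssentialSubmodule.finite_of_finite (k : Type v) [Field k] [Algebra k A]
    [FiniteDimensional k A] [IsNoetherianRing A] {I : Type u} [AddCommGroup I] [Module A I]
    {N : Submodule A I} [Module.Finite A N] (h : IsEssentialSubmodule A N) :
    Module.Finite A I := by
  obtain ⟨E, e, hfin, hinj, he⟩ := exists_finite_injective_embedding k (A := A) N
  obtain ⟨g, hg⟩ := hinj.out N.subtype N.subtype_injective e
  have hg' : g ∘ₗ N.subtype = e := LinearMap.ext hg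
  exact Module.Finite.of_injective g
    (IsEssentialSubmodule.injective_of_injective_comp (j := N.subtype)
      (by rwa [Submodule.range_subtype]) g (by rwa [hg']))

namespace MinimalInjectiveCoresolution

variable {M : Type u} [AddCommGroup M] [Module A M] (R : MinimalInjectiveCoresolution A M)

lemma finite (k : Type v) [Field k] [Algebra k A] [FiniteDimensional k A] [IsNoetherianRing A]
    [Module.Finite A M] (n : ℕ) : Module.Finite A (R.I n) := by
  induction n with
  | zero => exact R.essential_zero.finite_of_finite k
  | succ n ih => exact (R.essential_succ n).finite_of_finite k

lemma essential_ker (n : ℕ) : IsEssentialSubmodule A (LinearMap.ker (R.d n)) := by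
  cases n with
  | zero => rw [R.exact_zero.linearMap_ker_eq]; exact R.essential_zero
  | succ n => rw [(R.exact_succ n).linearMap_ker_eq]; exact R.essential_succ n

/-- The map `I n → ker d (n + 1)` induced by the differential; its kernel is `ker d n`. -/
def toKer (n : ℕ) : R.I n →ₗ[A] LinearMap.ker (R.d (n + 1)) :=
  (R.d n).codRestrict _ fun x => (R.exact_succ n).apply_apply_eq_zero x

lemma toKer_eq_zero_iff (n : ℕ) (x : R.I n) : R.toKer n x = 0 ↔ x ∈ LinearMap.ker (R.d n) :=
  Subtype.ext_iff

lemma shortExact (n : ℕ) :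
    (ShortComplex.mk (ModuleCat.ofHom (LinearMap.ker (R.d n)).subtype)
      (ModuleCat.ofHom (R.toKer n))
      (by ext x; exact congrArg Subtype.val ((R.toKer_eq_zero_iff n _).mpr x.2))).ShortExact := by
  refine shortExact_of_exact _ _ (Submodule.subtype_injective _) ?_ fun x => ?_
  · rintro ⟨y, hy⟩
    obtain ⟨x, rfl⟩ := (R.exact_succ n y).mp hy
    exact ⟨x, rfl⟩
  · rw [toKer_eq_zero_iff]
    exact ⟨fun h => ⟨⟨x, h⟩, rfl⟩, fun ⟨y, hy⟩ => hy ▸ y.2⟩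

/-- Dimension shift along the coresolution. In degree zero this uses minimality: a map from a
simple module to `I n` lands in the essential submodule `ker d n`. -/
lemma subsingleton_ext_ker_succ_iff (S : Type u) [AddCommGroup S] [Module A S]
    [IsSimpleModule A S] (n i : ℕ) :
    Subsingleton (Ext (ModuleCat.of A S) (ModuleCat.of A (LinearMap.ker (R.d (n + 1)))) i) ↔
      Subsingleton (Ext (ModuleCat.of A S) (ModuleCat.of A (LinearMap.ker (R.d n))) (i + 1)) := by
  have hI : Injective (R.I n) :=
    Module.injective_object_of_injective_module A (R.I n) (inj := R.injective n)
  have hS := R.shortExact n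
  constructor <;> refine fun h => subsingleton_of_forall_eq 0 fun x => ?_
  · obtain ⟨y, rfl⟩ := Ext.covariant_sequence_exact₁ _ hS x
      (Ext.eq_zero_of_injective (I := R.I n) _) rfl
    rw [Subsingleton.elim (α := Ext (ModuleCat.of A S)
      (ModuleCat.of A (LinearMap.ker (R.d (n + 1)))) i) y 0, Ext.zero_comp]
  · obtain ⟨y, rfl⟩ := Ext.covariant_sequence_exact₃ _ hS x rfl (Subsingleton.elim (α := Ext
      (ModuleCat.of A S) (ModuleCat.of A (LinearMap.ker (R.d n))) (i + 1)) _ _)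
    cases i with
    | zero =>
      obtain ⟨f, rfl⟩ := (Ext.mk₀_bijective _ _).2 y
      rw [Ext.mk₀_comp_mk₀, Ext.mk₀_eq_zero_iff]
      ext s
      exact congrArg Subtype.val ((R.toKer_eq_zero_iff n _).mpr
        ((R.essential_ker n).apply_mem_of_isSimpleModule f.hom s))
    | succ i => rw [Ext.eq_zero_of_injective (I := R.I n) y, Ext.zero_comp]

/-- For simple `S`, minimality gives `Extⁿ(S, M) ≅ Hom(S, I n)`. -/
lemma subsingleton_ext_iff (S : Type u) [AddCommGroup S] [Module A S] [IsSimpleModule A S]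
    (n : ℕ) : Subsingleton (Ext (ModuleCat.of A S) (ModuleCat.of A M) n) ↔
      ∀ f : S →ₗ[A] R.I n, f = 0 := by
  have shift (n : ℕ) : ∀ i,
      Subsingleton (Ext (ModuleCat.of A S) (ModuleCat.of A (LinearMap.ker (R.d n))) i) ↔
      Subsingleton (Ext (ModuleCat.of A S) (ModuleCat.of A (LinearMap.ker (R.d 0))) (i + n)) := by
    induction n with
    | zero => exact fun i => Iff.rfl
    | succ n ih =>
      intro i
      rw [subsingleton_ext_ker_succ_iff, ih, show i + (n + 1) = i + 1 + n by omega]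
  have e : M ≃ₗ[A] LinearMap.ker (R.d 0) :=
    LinearEquiv.ofInjective R.ι R.ι_injective ≪≫ₗ
      LinearEquiv.ofEq _ _ R.exact_zero.linearMap_ker_eq.symm
  have h0 := shift n 0
  rw [zero_add n] at h0
  rw [subsingleton_ext_congr_right _ e, ← h0, subsingleton_ext_zero_iff]
  constructor
  · intro h f
    have hf := h (f.codRestrict _ ((R.essential_ker n).apply_mem_of_isSimpleModule f))
    ext s
    exact congrArg Subtype.val (LinearMap.congr_fun hf s)
  · intro h f
    ext s
    exact LinearMap.congr_fun (h ((LinearMap.ker (R.d n)).subtype ∘ₗ f)) s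

end MinimalInjectiveCoresolution

end Coresolution

/-! ### Projectivity of injective modules and dominant dimension -/

section DominantDimensionFormula

variable {A : Type u} [Ring A]

/-- A finitely generated torsionless injective module is a direct summand of a free module. -/
lemma projective_of_torsionPart_eq_bot [IsArtinianRing A] {I : Type u} [AddCommGroup I]
    [Module A I] [Module.Finite A I] (hI : Module.Injective A I) (h : torsionPart A I = ⊥) :
    Module.Projective A I := by
  classical
  -- By the descending chain condition, finitely many maps to `A` have trivial common kernel.
  obtain ⟨_, ⟨s, rfl⟩, hmin⟩ := IsArtinian.set_has_minimal
    (Set.range fun s : Finset (I →ₗ[A] A) => s.inf LinearMap.ker) (Set.range_nonempty _)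
  have hs : s.inf LinearMap.ker = ⊥ := by
    rw [eq_bot_iff, ← h]
    intro x hx
    refine mem_torsionPart_iff.mpr fun f => ?_
    have hle : (insert f s).inf LinearMap.ker ≤ s.inf LinearMap.ker :=
      Finset.inf_mono (Finset.subset_insert f s)
    have heq := eq_of_le_of_not_lt hle (hmin _ ⟨insert f s, rfl⟩)
    rw [← heq, Finset.inf_insert] at hx
    exact hx.1
  let j : I →ₗ[A] (s → A) := LinearMap.pi fun f => f.1
  have hj : Function.Injective j := by
    rw [← LinearMap.ker_eq_bot, eq_bot_iff, ← hs]
    intro x hx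
    rw [Submodule.mem_finsetInf]
    exact fun f hf => congrFun hx ⟨f, hf⟩
  obtain ⟨r, hr⟩ := hI.out j hj LinearMap.id
  exact Module.Projective.of_split j r (LinearMap.ext hr)

lemma IsTorsionOverRegular.eq_zero_of_projective {N P : Type u} [AddCommGroup N] [Module A N]
    [AddCommGroup P] [Module A P] (h : IsTorsionOverRegular A N) (hP : Module.Projective A P)
    (f : N →ₗ[A] P) : f = 0 := by
  obtain ⟨s, hs⟩ := Module.projective_def.mp hP
  have hsf (x : N) : s (f x) = 0 := Finsupp.ext fun p =>
    LinearMap.congr_fun (h (Finsupp.lapply p ∘ₗ s ∘ₗ f)) x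
  ext x
  rw [← hs (f x), hsf, map_zero, LinearMap.zero_apply]

/-- If the torsion class is closed under submodules, a finitely generated injective module is
projective exactly when its socle has no torsion simple summand. -/
lemma projective_iff_forall_simple [IsArtinianRing A] (h : 2 ≤ infGradeTorsion A) {I : Type u}
    [AddCommGroup I] [Module A I] [Module.Finite A I] (hI : Module.Injective A I) :
    Module.Projective A I ↔ ∀ (S : Type u) [AddCommGroup S] [Module A S], IsSimpleModule A S →
      IsTorsionOverRegular A S → ∀ f : S →ₗ[A] I, f = 0 := by
  refine ⟨fun hP S _ _ _ hS f => hS.eq_zero_of_projective hP f, fun hS => ?_⟩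
  refine projective_of_torsionPart_eq_bot hI ?_
  by_contra hne
  have := Submodule.nontrivial_iff_ne_bot.mpr hne
  obtain ⟨S, hSatom⟩ := IsAtomic.exists_atom (Submodule A (torsionPart A I))
  have hsimple : IsSimpleModule A S := isSimpleModule_iff_isAtom.mpr hSatom
  have hzero := hS S hsimple ((isTorsionOverRegular_torsionPart h I).submodule h S)
    ((torsionPart A I).subtype ∘ₗ S.subtype)
  refine hSatom.1 (eq_bot_iff.mpr fun x hx => ?_)
  exact Subtype.ext (LinearMap.congr_fun hzero ⟨x, hx⟩)

theorem domdim_eq_infGradeTorsionSimple (k : Type v) [Field k] [Algebra k A]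
    [FiniteDimensional k A] [IsArtinianRing A] (h : 2 ≤ infGradeTorsion A) :
    domdim A A = infGradeTorsionSimple A := by
  apply le_antisymm
  · refine le_infGradeTorsionSimple fun S _ _ hS ht n hn => ?_
    obtain ⟨R⟩ := nonempty_minimalInjectiveCoresolution A k A
    refine (iInf_le _ R).trans (iInf₂_le n fun hproj => not_subsingleton_iff_nontrivial.mpr hn ?_)
    exact (R.subsingleton_ext_iff S n).mpr fun f => ht.eq_zero_of_projective hproj f
  · refine le_iInf fun R => le_iInf₂ fun n hn => ?_
    have := R.finite k n
    rw [projective_iff_forall_simple h (R.injective n)] at hn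
    push Not at hn
    obtain ⟨S, _, _, hS, ht, f, hf⟩ := hn
    refine infGradeTorsionSimple_le_of_nontrivial_ext hS ht ?_
    rw [← not_subsingleton_iff_nontrivial, R.subsingleton_ext_iff S n]
    exact fun h0 => hf (h0 f)

end DominantDimensionFormula

end

theorem theorem4p6 (k : Type v) [Field k] (A : Type u) [Ring A] [Algebra k A]
    [FiniteDimensional k A] (h : 2 ≤ infGradeExt A ∨ 2 ≤ infGradeTorsion A) :
    domdim A A = infGradeExt A ∧
      infGradeExt A = infGradeTorsion A ∧
      infGradeTorsion A = infGradeTorsionSimple A := by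
  have : IsArtinianRing A := isArtinian_of_tower k inferInstance
  have : IsNoetherianRing Aᵐᵒᵖ := isNoetherian_of_tower k inferInstance
  have hE : infGradeExt A = infGradeTorsion A := infGradeExt_eq_infGradeTorsion
  have hT : 2 ≤ infGradeTorsion A := h.elim (fun h => hE ▸ h) id
  have hS := infGradeTorsion_eq_infGradeTorsionSimple hT
  exact ⟨(domdim_eq_infGradeTorsionSimple k hT).trans (hE.trans hS).symm, hE, hS⟩
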